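/- **Theorem 3.2.** Let $p=p(n)\in[0,1]$ satisfy $p=\omega(1/n)$, i.e. $p(n)/(1/n)\to\infty$ as $n\to\infty$. Let $G^\sigma(n,p)$ be the random oriented graph on $n$ vertices in which each pair of vertices is joined by an edge independently with probability $p$, and each existing edge is then oriented, independently, in either direction with probability $1/2$. The skew-adjacency matrix of an oriented graph has entries $s_{ij}=1$ and $s_{ji}=-1$ if $\langle v_i,v_j\rangle$ is an arc, and $s_{ij}=s_{ji}=0$ if $v_i,v_j$ are not joined; the skew energy $\mathcal E_S$ is the sum of the absolute values of all its (complex) eigenvalues, counted with multiplicity. Then almost surely $$\mathcal E_S(G^\sigma(n,p))=n^{3/2}p^{1/2}\left(\frac{8}{3\pi}+o(1)\right),$$ where, as usual for random graphs, "almost surely" means with probability tending to $1$; that is, there is a sequence of real numbers $\delta_n\to0$ such that the probability that $\mathcal E_S(G^\sigma(n,p))=n^{3/2}p^{1/2}\left(\frac{8}{3\pi}+r\right)$ for some real $r$ with $|r|\le\delta_n$ tends to $1$ as $n\to\infty$. Moreover $\int_{\mathbb R}|x|\,\rho_{sc}(x)\,dx=\frac{8}{3\pi}$, where $\rho_{sc}(x)=\frac1{2\pi}\sqrt{4-x^2}$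 for $|x|\le2$ and $\rho_{sc}(x)=0$ otherwise. -/

import Mathlib

open MeasureTheory ProbabilityTheory Filter Topology
open scoped unitInterval

/-- An oriented graph on the vertex set `V`: every pair of vertices spans at most one arc, and there
are no loops (asymmetry implies irreflexivity). -/
@[ext]
structure OrientedGraph (V : Type*) where
  /-- `Arc u v` means that `⟨u, v⟩` is an arc. -/
  Arc : V → V → Prop
  asymm : ∀ u v, Arc u v → ¬ Arc v u

namespace OrientedGraph

instance (V : Type*) : MeasurableSpace (OrientedGraph V) := ⊤

open Classical in
/-- The skew-adjacency matrix of an oriented graph (with complex entries). -/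
noncomputable def skewAdjMatrix {V : Type*} (G : OrientedGraph V) : Matrix V V ℂ :=
  Matrix.of fun u v => if G.Arc u v then 1 else if G.Arc v u then -1 else 0

open Classical in
/-- The skew energy: the sum of the absolute values of all eigenvalues of the skew-adjacency
matrix, counted with algebraic multiplicity. -/
noncomputable def skewEnergy {V : Type*} [Fintype V] (G : OrientedGraph V) : ℝ :=
  (G.skewAdjMatrix.charpoly.roots.map fun z => ‖z‖).sum

/-- The unordered pairs of distinct vertices among `0, …, n - 1`, written with the smaller vertex
first. -/
abbrev VertexPair (n : ℕ) : Type := {e : Fin n × Fin n // e.1 < e.2}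

/-- The oriented graph determined by two bits for each pair `u < v`: the first bit says whether
the edge `uv` is drawn, the second whether it is oriented from `u` to `v` or from `v` to `u`. -/
def ofBits {n : ℕ} (ω : VertexPair n → Bool × Bool) : OrientedGraph (Fin n) where
  Arc u v := (∃ h : u < v, ω ⟨(u, v), h⟩ = (true, true)) ∨
    (∃ h : v < u, ω ⟨(v, u), h⟩ = (true, false))
  asymm := by
    rintro u v (⟨h, e⟩ | ⟨h, e⟩) (⟨h', e'⟩ | ⟨h', e'⟩)
    · exact absurd h (lt_asymm h')
    · simp [e] at e'
    · simp [e] at e'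
    · exact absurd h (lt_asymm h')

theorem measurable_ofBits (n : ℕ) : Measurable (ofBits (n := n)) :=
  measurable_of_countable _

end OrientedGraph

/-- The probability `1/2` as an element of the unit interval. -/
noncomputable def oneHalf : I := ⟨1 / 2, by norm_num, by norm_num⟩

/-- The law of the two bits attached to one pair of vertices: the edge is drawn with probability
`p` and, independently, each of the two orientations is chosen with probability `1/2`. -/
noncomputable def pairLaw (p : I) : Measure (Bool × Bool) :=
  (bernoulliMeasure true false p).prod (bernoulliMeasure true false oneHalf)

instance (p : I) : IsProbabilityMeasure (pairLaw p) := by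
  unfold pairLaw; infer_instance

/-- The law of the random oriented graph `G^σ(n,p)`: all pairs of vertices are treated
independently. -/
noncomputable def randomOrientedGraph (n : ℕ) (p : I) : Measure (OrientedGraph (Fin n)) :=
  (Measure.pi fun _ : OrientedGraph.VertexPair n => pairLaw p).map OrientedGraph.ofBits

instance (n : ℕ) (p : I) : IsProbabilityMeasure (randomOrientedGraph n p) :=
  Measure.isProbabilityMeasure_map (OrientedGraph.measurable_ofBits n).aemeasurable

/-- "Almost surely" in the sense of random graph theory: the probability of the property tends
to `1` as `n → ∞`. -/
def AsymptoticallyAlmostSurely {Ω : ℕ → Type*} [∀ n, MeasurableSpace (Ω n)]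
    (μ : ∀ n, Measure (Ω n)) (P : ∀ n, Ω n → Prop) : Prop :=
  Tendsto (fun n => μ n {x | P n x}) atTop (𝓝 1)

/-- The density of the standard semicircle distribution. -/
noncomputable def semicircleDensity (x : ℝ) : ℝ :=
  if |x| ≤ 2 then 1 / (2 * Real.pi) * Real.sqrt (4 - x ^ 2) else 0

/-! Let c = 1/√(np), let S be the real skew-adjacency matrix, with eigenvalues -i·x_k, and for t > 0
put R = (t + cS)⁻¹ and m(t) = tr R / n. Since |x| = (2/π)∫₀^∞ x²/(x² + t²) dt, the rescaled energy
(c/n)∑|x_k| equals (2/π)∫₀^∞ (1 - t·m(t)) dt. The semicircle counterpart s(t) of m(t) is the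
positive root of ts + s² = 1, and ∫₀^∞ (1 - ts) dt = 4/3 produces the constant 8/(3π). It remains to
show that m is close to s.

Put F = m - s. Taking the trace of (t + cS)R = 1 gives 1 - tm = (1/n)∑ cS_ij R_ji. Switching off the
pair {i, j} changes S by a matrix of rank at most two and leaves a graph independent of S_ij. As
cS_ij has mean 0 and variance 1/n for i ≠ j, a second-order expansion gives E[cS_ij R_ji F] ≈
E[(R_ii R_jj - R_ji²)F]/n (`abs_integral_entry_le`). Summed over i and j this reads E[(1 - tm -
m²)F] ≈ 0, and the bracket is exactly -(t + m + s)F, so t·E[F²] is small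
(`integral_sq_resolventMean_sub_le`). The weight F inside the expectation controls bias and
fluctuation at once, so no separate concentration estimate is needed.

The error is O(1/n + c) for fixed t but degenerates as t → 0. A majorant 3/(1 + t²), uniform in n
(`meanDeviation_le`), allows dominated convergence over t, and Markov's inequality turns the
resulting L¹ convergence into convergence in probability. -/

/-! ### Scalar integrals for the semicircle law. -/

/-- The Stieltjes transform of the semicircle law along the imaginary axis, `t ↦ Im m(it)`. -/
noncomputable def semicircleResolvent (t : ℝ) : ℝ := (Real.sqrt (t ^ 2 + 4) - t) / 2

theorem semicircleResolvent_pos (t : ℝ) : 0 < semicircleResolvent t := by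
  have : |t| < Real.sqrt (t ^ 2 + 4) := by
    rw [← Real.sqrt_sq_eq_abs]
    exact Real.sqrt_lt_sqrt (sq_nonneg t) (by linarith)
  unfold semicircleResolvent
  linarith [le_abs_self t]

theorem semicircleResolvent_eq (t : ℝ) :
    t * semicircleResolvent t + semicircleResolvent t ^ 2 = 1 := by
  have h := Real.sq_sqrt (show 0 ≤ t ^ 2 + 4 by positivity)
  unfold semicircleResolvent
  linear_combination h / 4

theorem semicircleResolvent_le {t : ℝ} (ht : 0 < t) : semicircleResolvent t ≤ t⁻¹ := by
  have h := semicircleResolvent_eq t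
  rw [← one_div, le_div_iff₀ ht]
  nlinarith [sq_nonneg (semicircleResolvent t)]

theorem hasDerivAt_semicircleResolvent (t : ℝ) :
    HasDerivAt semicircleResolvent (-semicircleResolvent t / Real.sqrt (t ^ 2 + 4)) t := by
  have hpos : 0 < t ^ 2 + 4 := by positivity
  have h1 : HasDerivAt (fun t : ℝ => t ^ 2 + 4) (2 * t) t := by
    simpa using (hasDerivAt_pow 2 t).add_const (4 : ℝ)
  have h := ((h1.sqrt hpos.ne').sub (hasDerivAt_id t)).div_const 2
  refine h.congr_deriv ?_
  have hs : Real.sqrt (t ^ 2 + 4) ≠ 0 := (Real.sqrt_pos.2 hpos).ne'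
  unfold semicircleResolvent
  field_simp
  ring

theorem tendsto_semicircleResolvent_atTop : Tendsto semicircleResolvent atTop (𝓝 0) :=
  squeeze_zero' (Eventually.of_forall fun t => (semicircleResolvent_pos t).le)
    ((eventually_gt_atTop 0).mono fun _ ht => semicircleResolvent_le ht) tendsto_inv_atTop_zero

/-- With s as variable, t = 1/s - s and 1 - ts = s², so (1 - ts) dt = -(1 + s²) ds, whose primitive
is -(s + s³/3). -/
theorem hasDerivAt_semicircleResolvent_primitive (t : ℝ) :
    HasDerivAt (fun t => -(semicircleResolvent t + semicircleResolvent t ^ 3 / 3))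
      (1 - t * semicircleResolvent t) t := by
  have h := hasDerivAt_semicircleResolvent t
  refine (h.add ((h.pow 3).div_const 3)).neg.congr_deriv ?_
  have hs : 0 < Real.sqrt (t ^ 2 + 4) := Real.sqrt_pos.2 (by positivity)
  have hsq := Real.sq_sqrt (show 0 ≤ t ^ 2 + 4 by positivity)
  have hne := hs.ne'
  unfold semicircleResolvent
  generalize Real.sqrt (t ^ 2 + 4) = w at *
  field_simp
  norm_num
  ring_nf
  linear_combination (3 / 4 * w + 3 / 4 * t) * hsq

/-- As t runs from 0 to ∞, s decreases from 1 to 0, whence 1 + 1/3. Multiplied by 2/π this is the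
constant of the theorem. -/
theorem integral_one_sub_mul_semicircleResolvent :
    IntegrableOn (fun t => 1 - t * semicircleResolvent t) (Set.Ioi 0) ∧
      ∫ t in Set.Ioi 0, (1 - t * semicircleResolvent t) = 4 / 3 := by
  have hpos : ∀ t ∈ Set.Ioi (0 : ℝ), 0 ≤ 1 - t * semicircleResolvent t := fun t _ => by
    nlinarith [semicircleResolvent_eq t, sq_nonneg (semicircleResolvent t)]
  have hlim : Tendsto (fun t => -(semicircleResolvent t + semicircleResolvent t ^ 3 / 3)) atTop
      (𝓝 0) := by
    have h := tendsto_semicircleResolvent_atTop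
    simpa using (h.add ((h.pow 3).div_const 3)).neg
  refine ⟨integrableOn_Ioi_deriv_of_nonneg'
    (fun t _ => hasDerivAt_semicircleResolvent_primitive t) hpos hlim, ?_⟩
  rw [integral_Ioi_of_hasDerivAt_of_nonneg'
    (fun t _ => hasDerivAt_semicircleResolvent_primitive t) hpos hlim]
  have h4 : Real.sqrt 4 = 2 := by
    rw [show (4 : ℝ) = 2 ^ 2 by norm_num]; exact Real.sqrt_sq (by norm_num)
  simp [semicircleResolvent, h4]
  norm_num

/-- The representation `|x| = (2 / π) ∫₀^∞ x² / (x² + t²) dt`. -/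
theorem integral_one_sub_sq_div (x : ℝ) :
    IntegrableOn (fun t => 1 - t * (t / (t ^ 2 + x ^ 2))) (Set.Ioi 0) ∧
      ∫ t in Set.Ioi 0, (1 - t * (t / (t ^ 2 + x ^ 2))) = Real.pi / 2 * |x| := by
  rcases eq_or_ne x 0 with rfl | hx
  · have h0 : Set.EqOn (fun t : ℝ => 1 - t * (t / (t ^ 2 + 0 ^ 2))) (fun _ => 0) (Set.Ioi 0) := by
      intro t ht
      have : t ≠ 0 := (Set.mem_Ioi.1 ht).ne'
      simp only
      field_simp
      simp
    refine ⟨(integrableOn_congr_fun h0 measurableSet_Ioi).2 integrableOn_zero, ?_⟩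
    rw [setIntegral_congr_fun measurableSet_Ioi h0]
    simp
  · have hpos : ∀ t ∈ Set.Ioi (0 : ℝ), 0 ≤ 1 - t * (t / (t ^ 2 + x ^ 2)) := fun t _ => by
      have : 0 < t ^ 2 + x ^ 2 := by positivity
      rw [← mul_div_assoc, sub_nonneg, div_le_one this]
      nlinarith [sq_nonneg x]
    have hx' : 0 < |x| := abs_pos.2 hx
    have hd : ∀ t ∈ Set.Ici (0 : ℝ), HasDerivAt (fun t => |x| * Real.arctan (t / |x|))
        (1 - t * (t / (t ^ 2 + x ^ 2))) t := fun t _ => by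
      refine ((((hasDerivAt_id t).div_const |x|).arctan).const_mul |x|).congr_deriv ?_
      have h1 : t ^ 2 + x ^ 2 ≠ 0 := by positivity
      have h2 : 1 + (t / |x|) ^ 2 ≠ 0 := by positivity
      rw [div_pow, sq_abs] at h2
      simp only [id, div_pow, sq_abs]
      field_simp
      ring_nf
    have hlim : Tendsto (fun t => |x| * Real.arctan (t / |x|)) atTop (𝓝 (|x| * (Real.pi / 2))) :=
      ((tendsto_nhds_of_tendsto_nhdsWithin Real.tendsto_arctan_atTop).comp
        (tendsto_id.atTop_div_const hx')).const_mul _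
    refine ⟨integrableOn_Ioi_deriv_of_nonneg' hd hpos hlim, ?_⟩
    rw [integral_Ioi_of_hasDerivAt_of_nonneg' hd hpos hlim]
    simp [mul_comm]

theorem integral_abs_mul_semicircleDensity :
    (∫ x : ℝ, |x| * semicircleDensity x) = 8 / (3 * Real.pi) := by
  have h1 : (fun x : ℝ => |x| * semicircleDensity x) =
      fun x => (fun y => y * semicircleDensity y) |x| := by
    funext x
    simp [semicircleDensity]
  have h2 : Set.EqOn (fun x : ℝ => x * semicircleDensity x)
      ((Set.Ioc 0 2).indicator fun x => 1 / (2 * Real.pi) * (x * Real.sqrt (4 - x ^ 2)))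
      (Set.Ioi 0) := by
    intro x hx
    have hx' : 0 < x := hx
    by_cases h : x ≤ 2
    · simp [semicircleDensity, Set.indicator, abs_of_pos hx', h, hx']
      ring
    · simp [semicircleDensity, Set.indicator, abs_of_pos hx', h]
  rw [h1, integral_comp_abs (f := fun y => y * semicircleDensity y), setIntegral_congr_fun measurableSet_Ioi h2,
    setIntegral_indicator measurableSet_Ioc,
    Set.inter_eq_self_of_subset_right Set.Ioc_subset_Ioi_self,
    ← intervalIntegral.integral_of_le zero_le_two, intervalIntegral.integral_const_mul]
  have h3 : ∫ x in (0 : ℝ)..2, x * Real.sqrt (4 - x ^ 2) = 8 / 3 := by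
    -- The primitive is -(4 - x²)^(3/2)/3. The open interval avoids x = 2, where the square root is
    -- not differentiable; continuity suffices at the endpoints.
    have hd : ∀ x ∈ Set.Ioo (0 : ℝ) 2,
        HasDerivAt (fun x => -((4 - x ^ 2) * Real.sqrt (4 - x ^ 2)) / 3)
          (x * Real.sqrt (4 - x ^ 2)) x := fun x hx => by
      have hpos : 0 < 4 - x ^ 2 := by nlinarith [hx.1, hx.2]
      have h0 : HasDerivAt (fun x : ℝ => 4 - x ^ 2) (-(2 * x)) x := by
        simpa using (hasDerivAt_pow 2 x).const_sub (4 : ℝ)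
      refine ((h0.mul (h0.sqrt hpos.ne')).neg.div_const 3).congr_deriv ?_
      have hs : Real.sqrt (4 - x ^ 2) ≠ 0 := (Real.sqrt_pos.2 hpos).ne'
      have hsq := Real.sq_sqrt hpos.le
      generalize Real.sqrt (4 - x ^ 2) = w at *
      field_simp
      linear_combination (-x) * hsq
    rw [intervalIntegral.integral_eq_sub_of_hasDerivAt_of_le zero_le_two (by fun_prop) hd
      (Continuous.intervalIntegrable (by fun_prop) _ _)]
    have h4 : Real.sqrt 4 = 2 := by
      rw [show (4 : ℝ) = 2 ^ 2 by norm_num]; exact Real.sqrt_sq (by norm_num)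
    norm_num [h4]
  rw [h3]
  field_simp

/-! ### Resolvents of real skew-symmetric matrices and their rank-two perturbations. -/

namespace Matrix

variable {ι : Type*} [Fintype ι] [DecidableEq ι]

/-- The resolvent `(t + A)⁻¹` of a real matrix. -/
noncomputable def shiftInv (A : Matrix ι ι ℝ) (t : ℝ) : Matrix ι ι ℝ :=
  (t • (1 : Matrix ι ι ℝ) + A)⁻¹

theorem dotProduct_mulVec_self_of_transpose_eq_neg {ι : Type*} [Fintype ι] {A : Matrix ι ι ℝ} (hA : Aᵀ = -A) (v : ι → ℝ) :
    v ⬝ᵥ A *ᵥ v = 0 := by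
  have h : v ⬝ᵥ A *ᵥ v = -(v ⬝ᵥ A *ᵥ v) := by
    conv_lhs => rw [dotProduct_mulVec, ← mulVec_transpose, hA, neg_mulVec, neg_dotProduct,
      dotProduct_comm]
  linarith

/-- The quadratic form of A vanishes, so v·(t + A)v = t|v|² and the kernel is trivial. -/
theorem isUnit_smul_one_add_of_transpose_eq_neg {A : Matrix ι ι ℝ} (hA : Aᵀ = -A) {t : ℝ}
    (ht : 0 < t) : IsUnit (t • (1 : Matrix ι ι ℝ) + A) := by
  rw [← mulVec_injective_iff_isUnit, ← coe_mulVecLin, injective_iff_map_eq_zero]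
  intro v hv
  rw [mulVecLin_apply] at hv
  have h : v ⬝ᵥ ((t • (1 : Matrix ι ι ℝ) + A) *ᵥ v) = t * (v ⬝ᵥ v) := by
    rw [add_mulVec, dotProduct_add, dotProduct_mulVec_self_of_transpose_eq_neg hA, smul_mulVec,
      one_mulVec, dotProduct_smul, smul_eq_mul, add_zero]
  rw [hv, dotProduct_zero] at h
  exact dotProduct_self_eq_zero.1 ((mul_eq_zero.1 h.symm).resolve_left ht.ne')

section Skew

variable {A : Matrix ι ι ℝ} {t : ℝ}

theorem mul_shiftInv (hA : Aᵀ = -A) (ht : 0 < t) :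
    (t • (1 : Matrix ι ι ℝ) + A) * shiftInv A t = 1 :=
  mul_nonsing_inv _ ((isUnit_iff_isUnit_det _).1 (isUnit_smul_one_add_of_transpose_eq_neg hA ht))

theorem shiftInv_mul (hA : Aᵀ = -A) (ht : 0 < t) :
    shiftInv A t * (t • (1 : Matrix ι ι ℝ) + A) = 1 :=
  nonsing_inv_mul _ ((isUnit_iff_isUnit_det _).1 (isUnit_smul_one_add_of_transpose_eq_neg hA ht))

/-- The transpose of t + A is t - A, and the two add up to 2t; sandwich this sum between Rᵀ and R.
The diagonal entries give the sums of squares of the columns of R, hence all the bounds by powers of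
1/t. -/
theorem transpose_shiftInv_mul_shiftInv (hA : Aᵀ = -A) (ht : 0 < t) :
    (2 * t) • ((shiftInv A t)ᵀ * shiftInv A t) = shiftInv A t + (shiftInv A t)ᵀ := by
  have h := mul_shiftInv hA ht
  set R := shiftInv A t
  have h1 : Rᵀ * ((t • (1 : Matrix ι ι ℝ) + A) * R) = Rᵀ := by rw [h, mul_one]
  have h2 := congrArg transpose h1
  simp only [transpose_mul, transpose_add, transpose_smul, transpose_one, transpose_transpose,
    hA] at h2
  calc _ = Rᵀ * (t • (1 : Matrix ι ι ℝ) + -A) * R + Rᵀ * ((t • (1 : Matrix ι ι ℝ) + A) * R) := by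
        simp only [add_mul, mul_add, smul_mul_assoc, mul_smul_comm, mul_one, one_mul, neg_mul,
          mul_neg, mul_assoc]
        module
    _ = _ := by rw [h1, h2]

theorem shiftInv_mul_transpose_shiftInv (hA : Aᵀ = -A) (ht : 0 < t) :
    (2 * t) • (shiftInv A t * (shiftInv A t)ᵀ) = shiftInv A t + (shiftInv A t)ᵀ := by
  have h := shiftInv_mul hA ht
  set R := shiftInv A t
  have h1 : R * (t • (1 : Matrix ι ι ℝ) + A) * Rᵀ = Rᵀ := by rw [h, one_mul]
  have h2 := congrArg transpose h1
  simp only [transpose_mul, transpose_add, transpose_smul, transpose_one, transpose_transpose,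
    hA] at h2
  calc _ = R * ((t • (1 : Matrix ι ι ℝ) + -A) * Rᵀ) + R * (t • (1 : Matrix ι ι ℝ) + A) * Rᵀ := by
        simp only [add_mul, mul_add, smul_mul_assoc, mul_smul_comm, mul_one, one_mul, neg_mul,
          mul_neg, mul_assoc]
        module
    _ = _ := by rw [h1, h2]

theorem sum_sq_shiftInv_col (hA : Aᵀ = -A) (ht : 0 < t) (j : ι) :
    t * ∑ i, shiftInv A t i j ^ 2 = shiftInv A t j j := by
  have h := congrFun (congrFun (transpose_shiftInv_mul_shiftInv hA ht) j) j
  simp only [smul_apply, mul_apply, transpose_apply, add_apply, smul_eq_mul, ← pow_two] at h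
  linarith

theorem sum_sq_shiftInv_row (hA : Aᵀ = -A) (ht : 0 < t) (i : ι) :
    t * ∑ j, shiftInv A t i j ^ 2 = shiftInv A t i i := by
  have h := congrFun (congrFun (shiftInv_mul_transpose_shiftInv hA ht) i) i
  simp only [smul_apply, mul_apply, transpose_apply, add_apply, smul_eq_mul, ← pow_two] at h
  linarith

theorem shiftInv_diag_nonneg (hA : Aᵀ = -A) (ht : 0 < t) (i : ι) : 0 ≤ shiftInv A t i i := by
  rw [← sum_sq_shiftInv_row hA ht]
  positivity

theorem shiftInv_diag_le (hA : Aᵀ = -A) (ht : 0 < t) (i : ι) : shiftInv A t i i ≤ t⁻¹ := by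
  have h := sum_sq_shiftInv_row hA ht i
  have h1 : shiftInv A t i i ^ 2 ≤ ∑ j, shiftInv A t i j ^ 2 :=
    Finset.single_le_sum (f := fun j => shiftInv A t i j ^ 2) (fun _ _ => sq_nonneg _)
      (Finset.mem_univ i)
  rw [← one_div, le_div_iff₀ ht]
  have h0 := shiftInv_diag_nonneg hA ht i
  have h2 := mul_le_mul_of_nonneg_left h1 ht.le
  rw [h] at h2
  by_contra! hlt
  nlinarith

theorem sum_sq_shiftInv_col_le (hA : Aᵀ = -A) (ht : 0 < t) (j : ι) :
    ∑ i, shiftInv A t i j ^ 2 ≤ t⁻¹ ^ 2 := by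
  have h := sum_sq_shiftInv_col hA ht j
  have h1 := shiftInv_diag_le hA ht j
  rw [← h] at h1
  rw [pow_two]
  calc _ = t⁻¹ * (t * ∑ i, shiftInv A t i j ^ 2) := by field_simp
    _ ≤ _ := by gcongr

theorem sum_sq_shiftInv_row_le (hA : Aᵀ = -A) (ht : 0 < t) (i : ι) :
    ∑ j, shiftInv A t i j ^ 2 ≤ t⁻¹ ^ 2 := by
  have h := sum_sq_shiftInv_row hA ht i
  have h1 := shiftInv_diag_le hA ht i
  rw [← h] at h1
  rw [pow_two]
  calc _ = t⁻¹ * (t * ∑ j, shiftInv A t i j ^ 2) := by field_simp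
    _ ≤ _ := by gcongr

theorem abs_shiftInv_le (hA : Aᵀ = -A) (ht : 0 < t) (i j : ι) : |shiftInv A t i j| ≤ t⁻¹ := by
  refine abs_le_of_sq_le_sq ?_ (by positivity)
  exact (Finset.single_le_sum (f := fun j => shiftInv A t i j ^ 2) (fun _ _ => sq_nonneg _)
    (Finset.mem_univ j)).trans (sum_sq_shiftInv_row_le hA ht i)

theorem trace_mul_shiftInv (hA : Aᵀ = -A) (ht : 0 < t) :
    ∑ i, ∑ j, A i j * shiftInv A t j i = Fintype.card ι - t * (shiftInv A t).trace := by
  have h := congrArg trace (mul_shiftInv hA ht)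
  rw [add_mul, trace_add, smul_mul_assoc, one_mul, trace_smul, trace_one, smul_eq_mul] at h
  rw [← h, add_sub_cancel_left]
  simp [trace, mul_apply]

variable {B : Matrix ι ι ℝ} {i j : ι} {a : ℝ}

/-- This is the resolvent identity R_A = R_A-free term minus R_A(A - B)R_B, with R_B as the free
term. It is exact: the left factors belong to A, the right ones to B. -/
theorem shiftInv_apply_eq_sub (hA : Aᵀ = -A) (hB : Bᵀ = -B) (ht : 0 < t)
    (hAB : A = B + (single i j a - single j i a)) (k l : ι) :
    shiftInv A t k l = shiftInv B t k l -
      a * (shiftInv A t k i * shiftInv B t j l - shiftInv A t k j * shiftInv B t i l) := by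
  have h : shiftInv A t =
      shiftInv B t - shiftInv A t * (single i j a - single j i a) * shiftInv B t := by
    have h1 : shiftInv A t * (t • (1 : Matrix ι ι ℝ) + B + (single i j a - single j i a)) = 1 := by
      rw [add_assoc, ← hAB, shiftInv_mul hA ht]
    have h2 := congrArg (· * shiftInv B t) h1
    simp only [mul_add _ (t • (1 : Matrix ι ι ℝ) + B), add_mul, mul_assoc, mul_shiftInv hB ht,
      one_mul, mul_one] at h2
    rw [eq_sub_iff_add_eq, mul_assoc]
    exact h2
  conv_lhs => rw [h]
  simp only [sub_apply, mul_sub, sub_mul, mul_apply, single_apply, mul_ite, mul_zero, ite_and,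
    Finset.sum_ite_eq, Finset.mem_univ, if_true, ite_mul, zero_mul]
  simp
  ring

theorem abs_shiftInv_apply_sub_le (hA : Aᵀ = -A) (hB : Bᵀ = -B) (ht : 0 < t)
    (hAB : A = B + (single i j a - single j i a)) (k l : ι) :
    |shiftInv A t k l - shiftInv B t k l| ≤ 2 * |a| * t⁻¹ ^ 2 := by
  rw [shiftInv_apply_eq_sub hA hB ht hAB k l, sub_sub_cancel_left, abs_neg, abs_mul]
  have h1 := abs_mul (shiftInv A t k i) (shiftInv B t j l)
  have h2 := abs_mul (shiftInv A t k j) (shiftInv B t i l)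
  have h3 : |shiftInv A t k i| * |shiftInv B t j l| ≤ t⁻¹ * t⁻¹ := by
    gcongr <;> apply abs_shiftInv_le <;> assumption
  have h4 : |shiftInv A t k j| * |shiftInv B t i l| ≤ t⁻¹ * t⁻¹ := by
    gcongr <;> apply abs_shiftInv_le <;> assumption
  have h5 := abs_sub (shiftInv A t k i * shiftInv B t j l) (shiftInv A t k j * shiftInv B t i l)
  calc _ ≤ |a| * (t⁻¹ * t⁻¹ + t⁻¹ * t⁻¹) := by gcongr; linarith
    _ = _ := by ring

theorem abs_sum_shiftInv_mul_shiftInv_le (hA : Aᵀ = -A) (hB : Bᵀ = -B) (ht : 0 < t) :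
    |∑ k, shiftInv A t k i * shiftInv B t j k| ≤ t⁻¹ ^ 2 := by
  have h1 := sum_sq_shiftInv_col_le hA ht i
  have h2 := sum_sq_shiftInv_row_le hB ht j
  calc _ ≤ ∑ k, |shiftInv A t k i * shiftInv B t j k| := Finset.abs_sum_le_sum_abs _ _
    _ ≤ ∑ k, (shiftInv A t k i ^ 2 + shiftInv B t j k ^ 2) / 2 := by
        refine Finset.sum_le_sum fun k _ => ?_
        rw [abs_mul, ← sq_abs (shiftInv A t k i), ← sq_abs (shiftInv B t j k)]
        nlinarith [sq_nonneg (|shiftInv A t k i| - |shiftInv B t j k|)]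
    _ ≤ _ := by
        rw [← Finset.sum_div, Finset.sum_add_distrib]
        linarith

/-- Summing the entrywise bound over the diagonal would cost a factor n. Pairing a column of one
resolvent with a row of the other avoids it, so a single edge moves the normalised trace by O(1/n)
only. -/
theorem abs_trace_shiftInv_sub_le (hA : Aᵀ = -A) (hB : Bᵀ = -B) (ht : 0 < t)
    (hAB : A = B + (single i j a - single j i a)) :
    |(shiftInv A t).trace - (shiftInv B t).trace| ≤ 2 * |a| * t⁻¹ ^ 2 := by
  have h : (shiftInv A t).trace - (shiftInv B t).trace =
      -(a * (∑ k, shiftInv A t k i * shiftInv B t j k -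
        ∑ k, shiftInv A t k j * shiftInv B t i k)) := by
    simp only [trace, diag_apply]
    rw [← Finset.sum_sub_distrib, ← Finset.sum_sub_distrib, Finset.mul_sum,
      ← Finset.sum_neg_distrib]
    refine Finset.sum_congr rfl fun k _ => ?_
    linear_combination shiftInv_apply_eq_sub hA hB ht hAB k k
  rw [h, abs_neg, abs_mul]
  have h1 := abs_sum_shiftInv_mul_shiftInv_le (i := i) (j := j) hA hB ht
  have h2 := abs_sum_shiftInv_mul_shiftInv_le (i := j) (j := i) hA hB ht
  have h3 := abs_sub (∑ k, shiftInv A t k i * shiftInv B t j k)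
    (∑ k, shiftInv A t k j * shiftInv B t i k)
  calc _ ≤ |a| * (t⁻¹ ^ 2 + t⁻¹ ^ 2) := by gcongr; linarith
    _ = _ := by ring

end Skew

end Matrix

/-! ### Spectral decomposition of a real skew-symmetric matrix. -/

namespace Matrix

variable {ι : Type*} [Fintype ι] [DecidableEq ι]

/-- Spectral data of a real skew-symmetric matrix `S`, whose complex eigenvalues are `-i x k`. -/
theorem exists_spectrum_of_transpose_eq_neg {S : Matrix ι ι ℝ} (hS : Sᵀ = -S) :
    ∃ x : ι → ℝ,
      ((S.map Complex.ofReal).charpoly.roots.map fun z => ‖z‖).sum = ∑ k, |x k| ∧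
      (∀ c t : ℝ, 0 < t →
        (shiftInv (c • S) t).trace = ∑ k, t / (t ^ 2 + (c * x k) ^ 2)) ∧
      ∑ k, x k ^ 2 = ∑ i, ∑ j, S i j ^ 2 := by
  set B : Matrix ι ι ℂ := S.map Complex.ofReal with hBdef
  have hBH : Bᴴ = -B := by
    ext i j
    have := congrFun (congrFun hS i) j
    simp only [transpose_apply, neg_apply] at this
    simp [hBdef, conjTranspose_apply, this]
  -- Multiplication by i makes the spectral theorem for Hermitian matrices applicable.
  have hH : (Complex.I • B).IsHermitian := by
    rw [IsHermitian, conjTranspose_smul, hBH]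
    simp
  set x := hH.eigenvalues
  set U : Matrix ι ι ℂ := hH.eigenvectorUnitary.1
  have hU1 : U * star U = 1 := mem_unitaryGroup_iff.1 hH.eigenvectorUnitary.2
  have hU2 : star U * U = 1 := mem_unitaryGroup_iff'.1 hH.eigenvectorUnitary.2
  have hspec : Complex.I • B = U * diagonal (fun k => (x k : ℂ)) * star U := by
    conv_lhs => rw [hH.spectral_theorem]
    rfl
  set D : Matrix ι ι ℂ := diagonal fun k => -Complex.I * (x k : ℂ) with hD
  have hB : B = U * D * star U := by
    have h1 : B = (-Complex.I) • (Complex.I • B) := by simp [smul_smul]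
    have h2 : D = (-Complex.I) • diagonal (fun k => (x k : ℂ)) := by
      rw [hD, ← diagonal_smul]; rfl
    rw [h1, hspec, h2, mul_smul_comm, smul_mul_assoc]
  refine ⟨x, ?_, ?_, ?_⟩
  · have hroots : B.charpoly.roots = Finset.univ.val.map fun k => -Complex.I * (x k : ℂ) := by
      rw [hB, charpoly_mul_comm, ← mul_assoc, hU2, one_mul, hD, charpoly_diagonal,
        Polynomial.roots_prod _ _
          (Finset.prod_ne_zero_iff.2 fun _ _ => Polynomial.X_sub_C_ne_zero _)]
      simp only [Polynomial.roots_X_sub_C, Multiset.bind_singleton]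
    rw [hroots, Multiset.map_map]
    simp
  · intro c t ht
    have hcS : (c • S)ᵀ = -(c • S) := by rw [transpose_smul, hS, smul_neg]
    set R := shiftInv (c • S) t
    have h1 : ((t : ℂ) • (1 : Matrix ι ι ℂ) + (c : ℂ) • B) * R.map Complex.ofReal = 1 := by
      have h := congrArg (fun M : Matrix ι ι ℝ => M.map Complex.ofRealHom) (mul_shiftInv hcS ht)
      simp only [Matrix.map_mul, Matrix.map_one _ (map_zero _) (map_one _)] at h
      refine Eq.trans ?_ h
      congr 1
      ext i j
      by_cases hij : i = j <;> simp [hBdef, hij]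
    have hne : ∀ k, (t : ℂ) - Complex.I * (c * x k) ≠ 0 := fun k h => by
      have := congrArg Complex.re h
      simp at this
      exact ht.ne' this
    have h2 : U * diagonal (fun k => ((t : ℂ) - Complex.I * (c * x k))⁻¹) * star U *
        ((t : ℂ) • (1 : Matrix ι ι ℂ) + (c : ℂ) • B) = 1 := by
      have e : (t : ℂ) • (1 : Matrix ι ι ℂ) + (c : ℂ) • B =
          U * diagonal (fun k => (t : ℂ) - Complex.I * (c * x k)) * star U := by
        have : diagonal (fun k => (t : ℂ) - Complex.I * (c * x k)) =
            (t : ℂ) • (1 : Matrix ι ι ℂ) + (c : ℂ) • D := by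
          ext i j
          by_cases hij : i = j
          · subst hij; simp [hD]; ring
          · simp [hD, hij]
        rw [this, mul_add, add_mul, mul_smul_comm, mul_smul_comm, smul_mul_assoc, smul_mul_assoc,
          mul_one, hU1, ← hB]
      rw [e]
      have : ∀ P Q : Matrix ι ι ℂ, U * P * star U * (U * Q * star U) = U * (P * Q) * star U := by
        intro P Q
        calc _ = U * P * (star U * U) * Q * star U := by simp only [mul_assoc]
          _ = _ := by rw [hU2, mul_one]; simp only [mul_assoc]
      rw [this, diagonal_mul_diagonal]
      simp only [inv_mul_cancel₀ (hne _), diagonal_one, mul_one, hU1]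
    have h3 : R.map Complex.ofReal =
        U * diagonal (fun k => ((t : ℂ) - Complex.I * (c * x k))⁻¹) * star U := by
      rw [← mul_one (U * _ * star U), ← h1, ← mul_assoc, h2, one_mul]
    have h4 := congrArg trace h3
    rw [trace_mul_comm, ← mul_assoc, hU2, one_mul, trace_diagonal] at h4
    -- The trace is real, so each 1/(t - i·c·x_k) may be replaced by its real part.
    have h5 := congrArg Complex.re h4
    have h6 : (trace (R.map Complex.ofReal)).re = R.trace := by simp [trace]
    rw [← h6, h5, Complex.re_sum]
    refine Finset.sum_congr rfl fun k _ => ?_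
    rw [Complex.inv_re]
    simp [Complex.normSq_apply]
    ring
  -- Both sides compute the squared Frobenius norm.
  · have h1 : trace (Bᴴ * B) = ∑ k, ((x k : ℂ)) ^ 2 := by
      have : Bᴴ * B = U * (star D * D) * star U := by
        rw [← star_eq_conjTranspose, hB, star_mul, star_mul, star_star]
        calc _ = U * star D * (star U * U) * D * star U := by simp only [mul_assoc]
          _ = _ := by rw [hU2, mul_one]; simp only [mul_assoc]
      rw [this, trace_mul_comm, ← mul_assoc, hU2, one_mul, hD, star_eq_conjTranspose,
        diagonal_conjTranspose, diagonal_mul_diagonal, trace_diagonal]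
      refine Finset.sum_congr rfl fun k _ => ?_
      simp
      linear_combination (-(x k : ℂ) ^ 2) * Complex.I_sq
    have h2 : trace (Bᴴ * B) = ((∑ i, ∑ j, S i j ^ 2 : ℝ) : ℂ) := by
      rw [Finset.sum_comm]
      simp [trace, mul_apply, hBdef, conjTranspose_apply, pow_two]
    rw [h1] at h2
    exact_mod_cast h2

end Matrix

/-! ### The random signs and the independence of one pair from the rest. -/

namespace OrientedGraph

/-- The sign `1`, `-1` or `0` of a pair of vertices, according to the two bits of the pair. -/
def bitSign (b : Bool × Bool) : ℝ := if b.1 then (if b.2 then 1 else -1) else 0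

theorem sq_bitSign (b : Bool × Bool) : bitSign b ^ 2 = |bitSign b| := by
  rcases b with ⟨_ | _, _ | _⟩ <;> simp [bitSign]

theorem abs_bitSign_pow_three (b : Bool × Bool) : |bitSign b| ^ 3 = |bitSign b| := by
  rcases b with ⟨_ | _, _ | _⟩ <;> simp [bitSign]

variable {n : ℕ}

/-- The real skew-adjacency matrix of the oriented graph determined by `ω`. -/
def signMatrix (ω : VertexPair n → Bool × Bool) : Matrix (Fin n) (Fin n) ℝ :=
  Matrix.of fun u v =>
    if h : u < v then bitSign (ω ⟨(u, v), h⟩)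
    else if h : v < u then -bitSign (ω ⟨(v, u), h⟩) else 0

theorem map_signMatrix (ω : VertexPair n → Bool × Bool) :
    (signMatrix ω).map Complex.ofReal = (ofBits ω).skewAdjMatrix := by
  ext u v
  rcases lt_trichotomy u v with h | rfl | h
  · have h' := h.not_gt
    rcases hω : ω ⟨(u, v), h⟩ with ⟨_ | _, _ | _⟩ <;>
      simp [signMatrix, skewAdjMatrix, ofBits, bitSign, h, h', hω]
  · simp [signMatrix, skewAdjMatrix, ofBits]
  · have h' := h.not_gt
    rcases hω : ω ⟨(v, u), h⟩ with ⟨_ | _, _ | _⟩ <;>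
      simp [signMatrix, skewAdjMatrix, ofBits, bitSign, h, h', hω]

theorem transpose_signMatrix (ω : VertexPair n → Bool × Bool) :
    (signMatrix ω).transpose = -signMatrix ω := by
  ext u v
  rcases lt_trichotomy u v with h | rfl | h
  · simp [signMatrix, h, h.not_gt]
  · simp [signMatrix]
  · simp [signMatrix, h, h.not_gt]

theorem transpose_smul_signMatrix (c : ℝ) (ω : VertexPair n → Bool × Bool) :
    (c • signMatrix ω).transpose = -(c • signMatrix ω) := by
  rw [Matrix.transpose_smul, transpose_signMatrix, smul_neg]

theorem sum_sq_signMatrix (ω : VertexPair n → Bool × Bool) (u v : Fin n) :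
    signMatrix ω u v ^ 2 = |signMatrix ω u v| := by
  simp only [signMatrix, Matrix.of_apply]
  split_ifs <;> simp [sq_bitSign]

/-- Removing the edge of a single pair `{i, j}`. -/
theorem exists_signMatrix_eq_update_add {i j : Fin n} (hij : i ≠ j) :
    ∃ (e : VertexPair n) (s : ℝ), |s| = 1 ∧ ∀ ω : VertexPair n → Bool × Bool,
      signMatrix ω i j = s * bitSign (ω e) ∧
      signMatrix ω = signMatrix (Function.update ω e (false, false)) +
        (Matrix.single i j (s * bitSign (ω e)) - Matrix.single j i (s * bitSign (ω e))) := by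
  have key : ∀ (u v : Fin n) (h : u < v) (ω : VertexPair n → Bool × Bool),
      signMatrix ω = signMatrix (Function.update ω ⟨(u, v), h⟩ (false, false)) +
        (Matrix.single u v (bitSign (ω ⟨(u, v), h⟩)) -
          Matrix.single v u (bitSign (ω ⟨(u, v), h⟩))) := by
    intro u v h ω
    ext k l
    simp only [signMatrix, Matrix.of_apply, Matrix.add_apply, Matrix.sub_apply,
      Matrix.single_apply, Function.update_apply, Subtype.mk.injEq, Prod.mk.injEq]
    rcases lt_trichotomy k l with hkl | rfl | hkl
    · have h1 : ¬(v = k ∧ u = l) := by rintro ⟨rfl, rfl⟩; exact h.not_gt hkl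
      by_cases h2 : k = u ∧ l = v
      · obtain ⟨rfl, rfl⟩ := h2
        simp [hkl, h1, bitSign]
      · have h3 : ¬(u = k ∧ v = l) := fun h => h2 ⟨h.1.symm, h.2.symm⟩
        simp [hkl, h1, h2, h3]
    · have h1 : ¬(v = k ∧ u = k) := by rintro ⟨rfl, rfl⟩; exact h.false
      have h2 : ¬(u = k ∧ v = k) := fun h => h1 ⟨h.2, h.1⟩
      simp [h1, h2]
    · have h1 : ¬(u = k ∧ v = l) := by rintro ⟨rfl, rfl⟩; exact h.not_gt hkl
      by_cases h2 : l = u ∧ k = v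
      · obtain ⟨rfl, rfl⟩ := h2
        simp [hkl, hkl.not_gt, h1, bitSign]
      · have h3 : ¬(v = k ∧ u = l) := fun h => h2 ⟨h.2.symm, h.1.symm⟩
        simp [hkl, hkl.not_gt, h1, h2, h3]
  rcases lt_or_gt_of_ne hij with h | h
  · exact ⟨⟨(i, j), h⟩, 1, abs_one, fun ω => ⟨by simp [signMatrix, h], by
      simpa using key i j h ω⟩⟩
  -- Bits are stored with the smaller vertex first, so a reversed pair carries the sign -1.
  · refine ⟨⟨(j, i), h⟩, -1, by simp, fun ω => ⟨by simp [signMatrix, h, h.not_gt], ?_⟩⟩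
    conv_lhs => rw [key j i h ω]
    have hneg : ∀ (k l : Fin n) (x : ℝ), Matrix.single k l (-x) = -Matrix.single k l x :=
      fun k l x => by
        ext
        simp only [Matrix.single_apply, Matrix.neg_apply]
        split_ifs <;> simp
    simp only [neg_mul, one_mul, hneg]
    abel

/-- The law of the bits of all pairs of vertices. -/
noncomputable abbrev bitsLaw (n : ℕ) (p : I) : Measure (VertexPair n → Bool × Bool) :=
  Measure.pi fun _ => pairLaw p

theorem integral_pairLaw (p : I) (f : Bool × Bool → ℝ) :
    ∫ b, f b ∂pairLaw p = p * ((f (true, true) + f (true, false)) / 2) +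
      (1 - p) * ((f (false, true) + f (false, false)) / 2) := by
  rw [pairLaw, integral_prod _ Integrable.of_finite]
  simp only [integral_bernoulliMeasure, smul_eq_mul, oneHalf]
  ring

theorem integral_bitSign (p : I) : ∫ b, bitSign b ∂pairLaw p = 0 := by
  simp [integral_pairLaw, bitSign]

theorem integral_abs_bitSign (p : I) : ∫ b, |bitSign b| ∂pairLaw p = p := by
  simp [integral_pairLaw, bitSign]

theorem integral_bitsLaw_apply (p : I) (e : VertexPair n) (f : Bool × Bool → ℝ) :
    ∫ ω, f (ω e) ∂bitsLaw n p = ∫ b, f b ∂pairLaw p := by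
  have h := measurePreserving_eval (fun _ : VertexPair n => pairLaw p) e
  rw [← h.map_eq, integral_map h.measurable.aemeasurable
    (measurable_of_countable f).aestronglyMeasurable]

/-- A pair of vertices is independent of the graph in which this pair is switched off. -/
theorem integral_mul_update (p : I) (e : VertexPair n) (f : Bool × Bool → ℝ)
    (g : (VertexPair n → Bool × Bool) → ℝ) (b : Bool × Bool) :
    ∫ ω, f (ω e) * g (Function.update ω e b) ∂bitsLaw n p =
      (∫ x, f x ∂pairLaw p) * ∫ ω, g (Function.update ω e b) ∂bitsLaw n p := by
  have hind : iIndepFun (fun (i : VertexPair n) (ω : VertexPair n → Bool × Bool) => ω i)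
      (bitsLaw n p) := iIndepFun_pi (X := fun _ x => x) fun _ => aemeasurable_id
  have h1 := hind.indepFun_finset {e} (Finset.univ.erase e) (by simp)
    fun _ => measurable_of_countable _
  -- The updated configuration depends only on the coordinates other than `e`, the slot `e` being
  -- filled with `b`.
  let G : ({i // i ∈ Finset.univ.erase e} → Bool × Bool) → ℝ := fun x =>
    g fun i => if h : i ∈ Finset.univ.erase e then x ⟨i, h⟩ else b
  let F : (({e} : Finset (VertexPair n)) → Bool × Bool) → ℝ := fun x =>
    f (x ⟨e, Finset.mem_singleton_self e⟩)
  have h2 := h1.comp (φ := F) (ψ := G) (measurable_of_countable _) (measurable_of_countable _)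
  have hG : ∀ ω : VertexPair n → Bool × Bool,
      G (fun i => ω i) = g (Function.update ω e b) := fun ω => by
    refine congrArg g (funext fun i => ?_)
    by_cases h : i = e <;> simp [h, Function.update]
  have h3 := h2.integral_fun_mul_eq_mul_integral
    (measurable_of_countable _).aestronglyMeasurable
    (measurable_of_countable _).aestronglyMeasurable
  simp only [Function.comp_def, hG] at h3
  rw [h3, ← integral_bitsLaw_apply p e f]

end OrientedGraph

/-! ### Expansion in one edge and the approximate self-consistent equation. -/

theorem abs_mul_mul_sub_le {u d y z f y₀ z₀ f₀ : ℝ} (hz : |z| ≤ u) (hf : |f| ≤ u)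
    (hy₀ : |y₀| ≤ u) (hz₀ : |z₀| ≤ u) (hy : |y - y₀| ≤ d) (hzd : |z - z₀| ≤ d)
    (hfd : |f - f₀| ≤ d) : |y * z * f - y₀ * z₀ * f₀| ≤ 3 * d * u ^ 2 := by
  have hu : 0 ≤ u := (abs_nonneg _).trans hz
  have hd : 0 ≤ d := (abs_nonneg _).trans hy
  have h1 : |(y - y₀) * z * f| ≤ d * u * u := by
    rw [abs_mul, abs_mul]; gcongr
  have h2 : |y₀ * (z - z₀) * f| ≤ u * d * u := by
    rw [abs_mul, abs_mul]; gcongr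
  have h3 : |y₀ * z₀ * (f - f₀)| ≤ u * u * d := by
    rw [abs_mul, abs_mul]; gcongr
  have h4 := abs_add_three ((y - y₀) * z * f) (y₀ * (z - z₀) * f) (y₀ * z₀ * (f - f₀))
  calc _ = |(y - y₀) * z * f + y₀ * (z - z₀) * f + y₀ * z₀ * (f - f₀)| := by congr 1; ring
    _ ≤ _ := h4
    _ ≤ d * u * u + u * d * u + u * u * d := by gcongr
    _ = _ := by ring

/-- Second-order expansion in the weight `a` of one edge, where `x, y, z` stand for resolvent
entries, `f` for a function of the resolvent, and the index `₀` for the graph without the edge. -/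
theorem abs_cavity_expansion_le {u a N x y z f x₀ y₀ z₀ f₀ : ℝ} (hN : 1 ≤ N)
    (hx : |x| ≤ u) (hz : |z| ≤ u) (hf : |f| ≤ u)
    (hx₀ : |x₀| ≤ u) (hy₀ : |y₀| ≤ u) (hz₀ : |z₀| ≤ u)
    (hxd : |x - x₀| ≤ 2 * |a| * u ^ 2) (hyd : |y - y₀| ≤ 2 * |a| * u ^ 2)
    (hzd : |z - z₀| ≤ 2 * |a| * u ^ 2) (hfd : |f - f₀| ≤ 2 * |a| * u ^ 2 / N)
    (hexp : x = x₀ - a * (x * x₀ - y * z₀)) :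
    |a * x * f - (y * z - x * x) * f / N -
        (a * (x₀ * f₀) + (a ^ 2 - N⁻¹) * ((y₀ * z₀ - x₀ * x₀) * f₀))| ≤
      2 * u ^ 3 / N * |a| ^ 2 + 12 * u ^ 4 * (|a| ^ 3 + |a| / N) := by
  have hN0 : 0 < N := by linarith
  have hu : 0 ≤ u := (abs_nonneg _).trans hx
  set d := 2 * |a| * u ^ 2 with hd
  have hd0 : 0 ≤ d := by positivity
  have hfd' : |f - f₀| ≤ d := hfd.trans (div_le_self hd0 hN)
  have zero_le : ∀ v : ℝ, |v - v| ≤ d := fun v => by simpa using hd0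
  have e1 : |a * x₀ * (f - f₀)| ≤ |a| * u * (d / N) := by
    rw [abs_mul, abs_mul]; gcongr
  have e2 := abs_mul_mul_sub_le hz₀ hf hy₀ hz₀ hyd (zero_le z₀) hfd'
  have e3 := abs_mul_mul_sub_le hx₀ hf hx₀ hx₀ hxd (zero_le x₀) hfd'
  have e4 := abs_mul_mul_sub_le hz hf hy₀ hz₀ hyd hzd hfd'
  have e5 := abs_mul_mul_sub_le hx hf hx₀ hx₀ hxd hxd hfd'
  have e6 : |(y * z₀ - x * x₀) * f - (y₀ * z₀ - x₀ * x₀) * f₀| ≤ 6 * d * u ^ 2 := by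
    have := abs_sub (y * z₀ * f - y₀ * z₀ * f₀) (x * x₀ * f - x₀ * x₀ * f₀)
    calc _ = |y * z₀ * f - y₀ * z₀ * f₀ - (x * x₀ * f - x₀ * x₀ * f₀)| := by congr 1; ring
      _ ≤ _ := by linarith
  have e7 : |(y * z - x * x) * f - (y₀ * z₀ - x₀ * x₀) * f₀| ≤ 6 * d * u ^ 2 := by
    have := abs_sub (y * z * f - y₀ * z₀ * f₀) (x * x * f - x₀ * x₀ * f₀)
    calc _ = |y * z * f - y₀ * z₀ * f₀ - (x * x * f - x₀ * x₀ * f₀)| := by congr 1; ring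
      _ ≤ _ := by linarith
  have e8 : |a ^ 2 * ((y * z₀ - x * x₀) * f - (y₀ * z₀ - x₀ * x₀) * f₀)| ≤
      |a| ^ 2 * (6 * d * u ^ 2) := by
    rw [abs_mul, abs_pow]; gcongr
  have e9 : |((y * z - x * x) * f - (y₀ * z₀ - x₀ * x₀) * f₀) / N| ≤ 6 * d * u ^ 2 / N := by
    rw [abs_div, abs_of_pos hN0]; gcongr
  have e10 := abs_add_le (a * x₀ * (f - f₀))
    (a ^ 2 * ((y * z₀ - x * x₀) * f - (y₀ * z₀ - x₀ * x₀) * f₀))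
  have e11 := abs_sub (a * x₀ * (f - f₀) +
    a ^ 2 * ((y * z₀ - x * x₀) * f - (y₀ * z₀ - x₀ * x₀) * f₀))
    (((y * z - x * x) * f - (y₀ * z₀ - x₀ * x₀) * f₀) / N)
  calc _ = |a * x₀ * (f - f₀) +
        a ^ 2 * ((y * z₀ - x * x₀) * f - (y₀ * z₀ - x₀ * x₀) * f₀) -
        ((y * z - x * x) * f - (y₀ * z₀ - x₀ * x₀) * f₀) / N| := by
        -- Inserting `hexp` once turns a·x·f into a·x₀·f + a²(y·z₀ - x·x₀)·f. Replacing the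
        -- remaining factors by their values without the edge costs the three errors.
        congr 1
        linear_combination a * f * hexp
    _ ≤ |a| * u * (d / N) + |a| ^ 2 * (6 * d * u ^ 2) + 6 * d * u ^ 2 / N := by linarith
    _ = _ := by rw [hd]; ring

namespace OrientedGraph

variable {n : ℕ}

open Matrix in
/-- The normalised trace of the resolvent of the skew-adjacency matrix scaled by `c`. -/
noncomputable def resolventMean (c t : ℝ) (ω : VertexPair n → Bool × Bool) : ℝ :=
  (shiftInv (c • signMatrix ω) t).trace / n

theorem resolventMean_nonneg (c : ℝ) {t : ℝ} (ht : 0 < t) (ω : VertexPair n → Bool × Bool) :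
    0 ≤ resolventMean c t ω :=
  div_nonneg (Finset.sum_nonneg fun i _ =>
    Matrix.shiftInv_diag_nonneg (transpose_smul_signMatrix c ω) ht i) (Nat.cast_nonneg n)

theorem resolventMean_le (c : ℝ) {t : ℝ} (ht : 0 < t) (ω : VertexPair n → Bool × Bool) :
    resolventMean c t ω ≤ t⁻¹ := by
  refine div_le_of_le_mul₀ (Nat.cast_nonneg n) (by positivity) ?_
  refine (Finset.sum_le_card_nsmul _ _ t⁻¹ fun i _ =>
    Matrix.shiftInv_diag_le (transpose_smul_signMatrix c ω) ht i).trans ?_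
  simp [mul_comm]

theorem abs_resolventMean_sub_le (c : ℝ) {t : ℝ} (ht : 0 < t)
    (ω : VertexPair n → Bool × Bool) :
    |resolventMean c t ω - semicircleResolvent t| ≤ t⁻¹ := by
  have h1 := resolventMean_nonneg c ht ω
  have h2 := resolventMean_le c ht ω
  have h3 := semicircleResolvent_pos t
  have h4 := semicircleResolvent_le ht
  rw [abs_le]
  constructor <;> linarith

theorem abs_integral_le_of_abs_sub_le {Ω : Type*} [Finite Ω] [MeasurableSpace Ω]
    [MeasurableSingletonClass Ω] {μ : Measure Ω} [IsFiniteMeasure μ] {f g h : Ω → ℝ}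
    (hg : ∫ ω, g ω ∂μ = 0) (hfg : ∀ ω, |f ω - g ω| ≤ h ω) : |∫ ω, f ω ∂μ| ≤ ∫ ω, h ω ∂μ := by
  have h1 : ∫ ω, f ω ∂μ = ∫ ω, (f ω - g ω) ∂μ := by
    rw [integral_sub Integrable.of_finite Integrable.of_finite, hg, sub_zero]
  rw [h1]
  exact abs_integral_le_integral_abs.trans
    (integral_mono Integrable.of_finite Integrable.of_finite hfg)

open Matrix in
/-- The contribution of one entry to the approximate self-consistent equation. -/
theorem abs_integral_entry_le (p : I) (hn : 1 ≤ n) (hp : 0 < (p : ℝ)) {t : ℝ} (ht : 0 < t)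
    (i j : Fin n) (c : ℝ) (hc : c = (Real.sqrt (n * p))⁻¹) :
    |∫ ω, (c * signMatrix ω i j * shiftInv (c • signMatrix ω) t j i *
        (resolventMean c t ω - semicircleResolvent t) -
      (shiftInv (c • signMatrix ω) t j j * shiftInv (c • signMatrix ω) t i i -
        shiftInv (c • signMatrix ω) t j i * shiftInv (c • signMatrix ω) t j i) *
        (resolventMean c t ω - semicircleResolvent t) / n) ∂bitsLaw n p| ≤
      2 * t⁻¹ ^ 3 / n ^ 2 + 24 * t⁻¹ ^ 4 * c / n := by
  have hN : (1 : ℝ) ≤ n := by exact_mod_cast hn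
  have hN0 : (0 : ℝ) < n := by linarith
  have hc0 : 0 < c := by rw [hc]; positivity
  -- The normalisation gives each off-diagonal entry of the scaled matrix variance exactly 1/n.
  have hc2 : c ^ 2 * p = (n : ℝ)⁻¹ := by
    rw [hc, inv_pow, Real.sq_sqrt (by positivity)]
    field_simp
  rcases eq_or_ne i j with rfl | hij
  · have h0 : ∀ ω : VertexPair n → Bool × Bool, signMatrix ω i i = 0 := fun ω => by
      simp [signMatrix]
    simp only [h0, mul_zero, zero_mul, sub_self, zero_div, integral_zero, abs_zero]
    positivity
  obtain ⟨e, s, hs, hes⟩ := exists_signMatrix_eq_update_add hij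
  let up : (VertexPair n → Bool × Bool) → (VertexPair n → Bool × Bool) :=
    fun ω => Function.update ω e (false, false)
  let a : (VertexPair n → Bool × Bool) → ℝ := fun ω => c * (s * bitSign (ω e))
  let R : (VertexPair n → Bool × Bool) → Matrix (Fin n) (Fin n) ℝ :=
    fun ω => shiftInv (c • signMatrix ω) t
  let F : (VertexPair n → Bool × Bool) → ℝ :=
    fun ω => resolventMean c t ω - semicircleResolvent t
  let W : (VertexPair n → Bool × Bool) → ℝ := fun ω => (R ω j j * R ω i i - R ω j i * R ω j i) * F ω
  have hs2 : s ^ 2 = 1 := by rw [← sq_abs, hs, one_pow]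
  have ha : ∀ ω, |a ω| = c * |bitSign (ω e)| := fun ω => by
    simp only [a, abs_mul, hs, one_mul, abs_of_pos hc0]
  have ha2 : ∀ ω, a ω ^ 2 = c ^ 2 * |bitSign (ω e)| := fun ω => by
    simp only [a, mul_pow, hs2, one_mul, sq_bitSign]
  have hskew := fun ω : VertexPair n → Bool × Bool => transpose_smul_signMatrix c ω
  have hAB : ∀ ω, c • signMatrix ω = c • signMatrix (up ω) +
      (single i j (a ω) - single j i (a ω)) := fun ω => by
    conv_lhs => rw [(hes ω).2]
    rw [smul_add, smul_sub, smul_single, smul_single]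
    rfl
  -- The main part of the expansion has mean zero: the weight is independent of the graph without
  -- the edge, its mean is 0 and its second moment cancels 1/n.
  have hint : ∫ ω, (a ω * (R (up ω) j i * F (up ω)) + (a ω ^ 2 - (n : ℝ)⁻¹) * W (up ω))
      ∂bitsLaw n p = 0 := by
    rw [integral_add Integrable.of_finite Integrable.of_finite]
    have h1 : ∫ ω, a ω * (R (up ω) j i * F (up ω)) ∂bitsLaw n p = 0 := by
      have := integral_mul_update p e (fun b => c * (s * bitSign b)) (fun ω => R ω j i * F ω)
        (false, false)
      rw [integral_const_mul, integral_const_mul, integral_bitSign, mul_zero, mul_zero,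
        zero_mul] at this
      exact this
    have h2 : ∫ ω, (a ω ^ 2 - (n : ℝ)⁻¹) * W (up ω) ∂bitsLaw n p = 0 := by
      have := integral_mul_update p e (fun b => c ^ 2 * |bitSign b| - (n : ℝ)⁻¹) W (false, false)
      have hz : ∫ b, (c ^ 2 * |bitSign b| - (n : ℝ)⁻¹) ∂pairLaw p = 0 := by
        rw [integral_sub Integrable.of_finite Integrable.of_finite, integral_const_mul,
          integral_abs_bitSign, hc2]
        simp
      rw [hz, zero_mul] at this
      simpa only [ha2] using this
    rw [h1, h2, add_zero]
  have hbound : ∀ ω, |(a ω * R ω j i * F ω - W ω / n) -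
      (a ω * (R (up ω) j i * F (up ω)) + (a ω ^ 2 - (n : ℝ)⁻¹) * W (up ω))| ≤
      |bitSign (ω e)| * (2 * t⁻¹ ^ 3 / n * c ^ 2 + 12 * t⁻¹ ^ 4 * (c ^ 3 + c / n)) := fun ω => by
    have hfd : |F ω - F (up ω)| ≤ 2 * |a ω| * t⁻¹ ^ 2 / n := by
      simp only [F, resolventMean, sub_sub_sub_cancel_right]
      rw [← sub_div, abs_div, abs_of_pos hN0]
      gcongr
      exact abs_trace_shiftInv_sub_le (hskew _) (hskew _) ht (hAB ω)
    have h := abs_cavity_expansion_le hN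
      (abs_shiftInv_le (hskew ω) ht j i) (abs_shiftInv_le (hskew ω) ht i i) (abs_resolventMean_sub_le c ht ω)
      (abs_shiftInv_le (hskew (up ω)) ht j i) (abs_shiftInv_le (hskew (up ω)) ht j j)
      (abs_shiftInv_le (hskew (up ω)) ht i i)
      (abs_shiftInv_apply_sub_le (hskew _) (hskew _) ht (hAB ω) j i)
      (abs_shiftInv_apply_sub_le (hskew _) (hskew _) ht (hAB ω) j j)
      (abs_shiftInv_apply_sub_le (hskew _) (hskew _) ht (hAB ω) i i) hfd
      (shiftInv_apply_eq_sub (hskew _) (hskew _) ht (hAB ω) j i)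
    refine h.trans (le_of_eq ?_)
    -- A sign in {0, 1, -1} has equal absolute powers, so one factor `|bitSign (ω e)|`, of mean `p`,
    -- comes out of every error term.
    rw [ha ω, mul_pow, mul_pow, abs_bitSign_pow_three, sq_abs, sq_bitSign]
    ring
  have hmain := abs_integral_le_of_abs_sub_le (μ := bitsLaw n p) hint hbound
  rw [integral_mul_const, integral_bitsLaw_apply p e fun b => |bitSign b|,
    integral_abs_bitSign] at hmain
  have hL : ∀ ω, c * signMatrix ω i j = a ω := fun ω => by rw [(hes ω).1]
  simp only [hL]
  refine hmain.trans ?_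
  have hp1 : (p : ℝ) ≤ 1 := p.2.2
  calc _ = 2 * t⁻¹ ^ 3 / n * (c ^ 2 * p) + 12 * t⁻¹ ^ 4 * (c * (c ^ 2 * p) + c / n * p) := by
        ring
    _ ≤ 2 * t⁻¹ ^ 3 / n * (c ^ 2 * p) + 12 * t⁻¹ ^ 4 * (c * (c ^ 2 * p) + c / n * 1) := by
        gcongr
    _ = _ := by rw [hc2]; field_simp; ring

open Matrix in
/-- Quantitative convergence of the resolvent to that of the semicircle law. -/
theorem integral_sq_resolventMean_sub_le (p : I) (hn : 1 ≤ n) (hp : 0 < (p : ℝ)) {t : ℝ}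
    (ht : 0 < t) (c : ℝ) (hc : c = (Real.sqrt (n * p))⁻¹) :
    t * ∫ ω, (resolventMean c t ω - semicircleResolvent t) ^ 2 ∂bitsLaw n p ≤
      3 * t⁻¹ ^ 3 / n + 24 * t⁻¹ ^ 4 * c := by
  have hN0 : (0 : ℝ) < n := by exact_mod_cast hn
  let F : (VertexPair n → Bool × Bool) → ℝ :=
    fun ω => resolventMean c t ω - semicircleResolvent t
  let T : Fin n → Fin n → (VertexPair n → Bool × Bool) → ℝ := fun i j ω =>
    c * signMatrix ω i j * shiftInv (c • signMatrix ω) t j i * F ω -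
      (shiftInv (c • signMatrix ω) t j j * shiftInv (c • signMatrix ω) t i i -
        shiftInv (c • signMatrix ω) t j i * shiftInv (c • signMatrix ω) t j i) * F ω / n
  have hT : ∀ i j, |∫ ω, T i j ω ∂bitsLaw n p| ≤
      2 * t⁻¹ ^ 3 / n ^ 2 + 24 * t⁻¹ ^ 4 * c / n :=
    fun i j => abs_integral_entry_le p hn hp ht i j c hc
  have hsum : |∫ ω, (∑ i, ∑ j, T i j ω) / n ∂bitsLaw n p| ≤ 2 * t⁻¹ ^ 3 / n + 24 * t⁻¹ ^ 4 * c := by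
    rw [integral_div, integral_finsetSum _ fun _ _ => Integrable.of_finite]
    simp only [integral_finsetSum _ fun _ _ => Integrable.of_finite]
    rw [abs_div, abs_of_pos hN0, div_le_iff₀ hN0]
    calc |∑ i, ∑ j, ∫ ω, T i j ω ∂bitsLaw n p| ≤ ∑ i, ∑ j, |∫ ω, T i j ω ∂bitsLaw n p| :=
          (Finset.abs_sum_le_sum_abs _ _).trans
            (Finset.sum_le_sum fun i _ => Finset.abs_sum_le_sum_abs _ _)
      _ ≤ ∑ _i : Fin n, ∑ _j : Fin n, (2 * t⁻¹ ^ 3 / n ^ 2 + 24 * t⁻¹ ^ 4 * c / n) :=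
          Finset.sum_le_sum fun i _ => Finset.sum_le_sum fun j _ => hT i j
      _ = _ := by
          simp
          field_simp
  -- Subtracting ts + s² = 1 factors 1 - tm - m² as -(t + m + s)F. Since m + s ≥ 0, only tF² is
  -- kept; the sum of the R_ji² equals tr R / t and contributes the term of order 1/n.
  have hpt : ∀ ω, t * F ω ^ 2 ≤ -((∑ i, ∑ j, T i j ω) / n) + t⁻¹ ^ 3 / n := fun ω => by
    have hskew := transpose_smul_signMatrix c ω
    have h1 := trace_mul_shiftInv hskew ht
    set R := shiftInv (c • signMatrix ω) t with hR
    have h2 : ∑ i, ∑ j, R j j * R i i = R.trace ^ 2 := by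
      simp only [trace, diag_apply, pow_two, Finset.sum_mul_sum]
      rw [Finset.sum_comm]
    have h3 : t * ∑ i, ∑ j, R j i * R j i = R.trace := by
      simp only [trace, diag_apply, Finset.mul_sum]
      refine Finset.sum_congr rfl fun i _ => ?_
      have h := sum_sq_shiftInv_col hskew ht i
      simp only [pow_two, Finset.mul_sum] at h
      exact h
    have h4 : ∑ i, ∑ j, T i j ω = (n - t * R.trace) * F ω -
        (R.trace ^ 2 - ∑ i, ∑ j, R j i * R j i) * F ω / n := by
      simp only [Matrix.smul_apply, smul_eq_mul, Fintype.card_fin] at h1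
      rw [← h1, ← h2]
      simp only [T, ← hR, Finset.sum_sub_distrib, ← Finset.sum_mul, ← Finset.sum_div]
    have hm : R.trace = n * resolventMean c t ω := by
      rw [resolventMean]; field_simp; rfl
    have hFm : resolventMean c t ω = F ω + semicircleResolvent t := by simp [F]
    have h5 := semicircleResolvent_eq t
    have h6 := semicircleResolvent_pos t
    have h7 := resolventMean_nonneg c ht ω
    have h8 := resolventMean_le c ht ω
    have h9 : |F ω| ≤ t⁻¹ := abs_resolventMean_sub_le c ht ω
    set m := resolventMean c t ω
    have h10 : ∑ i, ∑ j, R j i * R j i = t⁻¹ * (n * m) := by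
      rw [← hm, ← h3]; field_simp
    have h11 : -((∑ i, ∑ j, T i j ω) / n) =
        (t + m + semicircleResolvent t) * F ω ^ 2 - t⁻¹ * m * F ω / n := by
      rw [h4, h10, hm]
      field_simp
      rw [hFm]
      linear_combination (t * n * F ω) * h5
    rw [h11]
    have h12 : t⁻¹ * m * F ω / n ≤ t⁻¹ ^ 3 / n := by
      gcongr
      calc t⁻¹ * m * F ω ≤ t⁻¹ * m * t⁻¹ := by gcongr; exact (le_abs_self _).trans h9
        _ ≤ t⁻¹ * t⁻¹ * t⁻¹ := by gcongr
        _ = _ := by ring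
    have h13 : 0 ≤ (m + semicircleResolvent t) * F ω ^ 2 := by positivity
    linarith
  have h := integral_mono (μ := bitsLaw n p) Integrable.of_finite Integrable.of_finite hpt
  rw [integral_const_mul, integral_add Integrable.of_finite Integrable.of_finite,
    integral_neg] at h
  simp only [integral_const, probReal_univ, one_smul] at h
  have h' := neg_abs_le (∫ ω, (∑ i, ∑ j, T i j ω) / n ∂bitsLaw n p)
  calc _ ≤ _ := h
    _ ≤ (2 * t⁻¹ ^ 3 / n + 24 * t⁻¹ ^ 4 * c) + t⁻¹ ^ 3 / n := by linarith
    _ = _ := by ring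

end OrientedGraph

/-! ### From the resolvent to the energy: integral formula, majorant and limit. -/

namespace OrientedGraph

variable {n : ℕ}

theorem one_sub_mul_sum_div (hn : 1 ≤ n) (x : Fin n → ℝ) (t : ℝ) :
    1 - t * ((∑ k, t / (t ^ 2 + x k ^ 2)) / n) =
      (∑ k, (1 - t * (t / (t ^ 2 + x k ^ 2)))) / n := by
  have hN0 : (n : ℝ) ≠ 0 := by positivity
  rw [Finset.sum_sub_distrib, ← Finset.mul_sum]
  simp
  field_simp

/-- The skew energy as an integral of the resolvent along the imaginary axis. -/
theorem integral_one_sub_mul_resolventMean (hn : 1 ≤ n) (c : ℝ)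
    (ω : VertexPair n → Bool × Bool) :
    IntegrableOn (fun t => 1 - t * resolventMean c t ω) (Set.Ioi 0) ∧
      ∫ t in Set.Ioi 0, (1 - t * resolventMean c t ω) =
        Real.pi / 2 * (|c| * (ofBits ω).skewEnergy / n) := by
  obtain ⟨x, hx1, hx2, -⟩ := Matrix.exists_spectrum_of_transpose_eq_neg (transpose_signMatrix ω)
  have hE : (ofBits ω).skewEnergy = ∑ k, |x k| := by
    rw [← hx1, map_signMatrix, skewEnergy]
    congr!
  have heq : Set.EqOn (fun t => 1 - t * resolventMean c t ω)
      (fun t => (∑ k, (1 - t * (t / (t ^ 2 + (c * x k) ^ 2)))) / n) (Set.Ioi 0) := by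
    intro t ht
    simp only
    rw [resolventMean, hx2 c t ht, one_sub_mul_sum_div hn fun k => c * x k]
  refine ⟨(integrableOn_congr_fun heq measurableSet_Ioi).2
    ((integrable_finsetSum _ fun k _ => (integral_one_sub_sq_div (c * x k)).1).div_const _), ?_⟩
  rw [setIntegral_congr_fun measurableSet_Ioi heq, integral_div,
    integral_finsetSum _ fun k _ => (integral_one_sub_sq_div (c * x k)).1]
  simp only [(integral_one_sub_sq_div _).2, hE, abs_mul, ← Finset.mul_sum]
  ring

/-- Each summand is y²/(t² + y²) ≤ y²/t² with y = c·x_k, and ∑ x_k² is the squared Frobenius norm,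
which counts the nonzero entries. This supplies the decay at large t. -/
theorem one_sub_mul_resolventMean_le (hn : 1 ≤ n) (c : ℝ) (ω : VertexPair n → Bool × Bool)
    {t : ℝ} (ht : 0 < t) :
    1 - t * resolventMean c t ω ≤ (t ^ 2)⁻¹ * (c ^ 2 / n) * ∑ i, ∑ j, |signMatrix ω i j| := by
  obtain ⟨x, -, hx2, hx3⟩ := Matrix.exists_spectrum_of_transpose_eq_neg (transpose_signMatrix ω)
  have hN0 : (0 : ℝ) < n := by exact_mod_cast hn
  simp only [sum_sq_signMatrix] at hx3
  rw [resolventMean, hx2 c t ht, one_sub_mul_sum_div hn fun k => c * x k, ← hx3, div_le_iff₀ hN0,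
    Finset.mul_sum, Finset.sum_mul]
  refine Finset.sum_le_sum fun k _ => ?_
  have h1 : 0 < t ^ 2 + (c * x k) ^ 2 := by positivity
  calc 1 - t * (t / (t ^ 2 + (c * x k) ^ 2)) = (c * x k) ^ 2 / (t ^ 2 + (c * x k) ^ 2) := by
        field_simp
        ring
    _ ≤ (c * x k) ^ 2 / t ^ 2 := by
        gcongr
        nlinarith [sq_nonneg (c * x k)]
    _ = _ := by field_simp

theorem integral_abs_signMatrix_le (p : I) (i j : Fin n) :
    ∫ ω, |signMatrix ω i j| ∂bitsLaw n p ≤ p := by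
  rcases eq_or_ne i j with rfl | hij
  · simp [signMatrix, p.2.1]
  · obtain ⟨e, s, hs, hes⟩ := exists_signMatrix_eq_update_add hij
    have h : ∀ ω : VertexPair n → Bool × Bool, |signMatrix ω i j| = |bitSign (ω e)| := fun ω => by
      rw [(hes ω).1, abs_mul, hs, one_mul]
    simp only [h]
    rw [integral_bitsLaw_apply p e fun b => |bitSign b|, integral_abs_bitSign]

/-- The expected deviation of the resolvent from that of the semicircle law at height `t`. -/
noncomputable def meanDeviation (n : ℕ) (p : I) (t : ℝ) : ℝ :=
  ∫ ω, |t * resolventMean (Real.sqrt (n * p))⁻¹ t ω - t * semicircleResolvent t| ∂bitsLaw n p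

theorem meanDeviation_nonneg (n : ℕ) (p : I) (t : ℝ) : 0 ≤ meanDeviation n p t :=
  integral_nonneg fun _ => abs_nonneg _

/-- The bound 1 serves for small t and 2/t² for large t; adding the first to t² times the second
gives 3. No dependence on n or p remains, as needed for dominated convergence. -/
theorem meanDeviation_le (hn : 1 ≤ n) {p : I} (hp : 0 < (p : ℝ)) {t : ℝ} (ht : 0 < t) :
    meanDeviation n p t ≤ 3 * (1 + t ^ 2)⁻¹ := by
  set c := (Real.sqrt (n * p))⁻¹ with hc
  have hN0 : (0 : ℝ) < n := by exact_mod_cast hn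
  have hc2 : c ^ 2 * p = (n : ℝ)⁻¹ := by
    rw [hc, inv_pow, Real.sq_sqrt (by positivity)]
    field_simp
  have hσ := semicircleResolvent_eq t
  have hσ1 := semicircleResolvent_pos t
  have hσ2 : semicircleResolvent t ^ 2 ≤ (t ^ 2)⁻¹ := by
    rw [← inv_pow]
    exact pow_le_pow_left₀ hσ1.le (semicircleResolvent_le ht) 2
  have h1 : meanDeviation n p t ≤ 1 := by
    calc meanDeviation n p t ≤ ∫ _, (1 : ℝ) ∂bitsLaw n p := by
          refine integral_mono Integrable.of_finite Integrable.of_finite fun ω => ?_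
          have := abs_resolventMean_sub_le c ht ω
          simp only
          rw [← mul_sub, abs_mul, abs_of_pos ht]
          calc _ ≤ t * t⁻¹ := by gcongr
            _ = 1 := mul_inv_cancel₀ ht.ne'
      _ = 1 := by simp
  have h2 : meanDeviation n p t ≤ 2 * (t ^ 2)⁻¹ := by
    have hpt : ∀ ω : VertexPair n → Bool × Bool,
        |t * resolventMean c t ω - t * semicircleResolvent t| ≤
          (t ^ 2)⁻¹ * (c ^ 2 / n) * (∑ i, ∑ j, |signMatrix ω i j|) + (t ^ 2)⁻¹ := fun ω => by
      have h3 := one_sub_mul_resolventMean_le hn c ω ht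
      have h4 : t * resolventMean c t ω ≤ 1 := by
        calc _ ≤ t * t⁻¹ := by gcongr; exact resolventMean_le c ht ω
          _ = 1 := mul_inv_cancel₀ ht.ne'
      have h5 : 0 ≤ semicircleResolvent t ^ 2 := sq_nonneg _
      have h6 : 0 ≤ (t ^ 2)⁻¹ := by positivity
      rw [abs_le]
      constructor <;> linarith
    have h7 := integral_mono (μ := bitsLaw n p) Integrable.of_finite Integrable.of_finite hpt
    rw [integral_add Integrable.of_finite Integrable.of_finite, integral_const_mul,
      integral_finsetSum _ fun _ _ => Integrable.of_finite] at h7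
    simp only [integral_finsetSum _ fun _ _ => Integrable.of_finite, integral_const,
      probReal_univ, one_smul] at h7
    calc _ ≤ _ := h7
      _ ≤ (t ^ 2)⁻¹ * (c ^ 2 / n) * (∑ _i : Fin n, ∑ _j : Fin n, (p : ℝ)) + (t ^ 2)⁻¹ := by
          gcongr
          exact integral_abs_signMatrix_le p _ _
      _ = (t ^ 2)⁻¹ * (n * (c ^ 2 * p)) + (t ^ 2)⁻¹ := by
          simp
          field_simp
      _ = _ := by
          rw [hc2]
          field_simp
          norm_num
  rw [← div_eq_mul_inv, le_div_iff₀ (by positivity)]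
  have h8 := mul_le_mul_of_nonneg_right h2 (sq_nonneg t)
  rw [mul_assoc, inv_mul_cancel₀ (by positivity)] at h8
  linarith

theorem sq_meanDeviation_le (hn : 1 ≤ n) {p : I} (hp : 0 < (p : ℝ)) {t : ℝ} (ht : 0 < t) :
    meanDeviation n p t ^ 2 ≤
      t * (3 * t⁻¹ ^ 3 * (n : ℝ)⁻¹ + 24 * t⁻¹ ^ 4 * (Real.sqrt (n * p))⁻¹) := by
  set c := (Real.sqrt (n * p))⁻¹ with hc
  have h1 := integral_sq_resolventMean_sub_le p hn hp ht c hc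
  -- Nonnegativity of the variance is the inequality (E|X|)² ≤ E[X²].
  have h2 := variance_nonneg
    (fun ω => |t * resolventMean c t ω - t * semicircleResolvent t|) (bitsLaw n p)
  rw [variance_eq_sub (MemLp.of_bound (measurable_of_countable _).aestronglyMeasurable 1
    (Eventually.of_forall fun ω => by
      rw [Real.norm_eq_abs, abs_abs, ← mul_sub, abs_mul, abs_of_pos ht]
      calc _ ≤ t * t⁻¹ := by gcongr; exact abs_resolventMean_sub_le c ht ω
        _ = 1 := mul_inv_cancel₀ ht.ne'))] at h2
  have h3 : ∫ ω, ((fun ω => |t * resolventMean c t ω - t * semicircleResolvent t|) ^ 2) ω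
      ∂bitsLaw n p =
      t * (t * ∫ ω, (resolventMean c t ω - semicircleResolvent t) ^ 2 ∂bitsLaw n p) := by
    rw [← integral_const_mul, ← integral_const_mul]
    congr 1
    funext ω
    rw [Pi.pow_apply, sq_abs]
    ring
  rw [h3] at h2
  have h4 : meanDeviation n p t ^ 2 ≤
      t * (t * ∫ ω, (resolventMean c t ω - semicircleResolvent t) ^ 2 ∂bitsLaw n p) := by
    rw [meanDeviation]
    linarith
  refine h4.trans ?_
  rw [div_eq_mul_inv] at h1
  gcongr

theorem integrableOn_abs_resolventMean_sub (hn : 1 ≤ n) (c : ℝ)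
    (ω : VertexPair n → Bool × Bool) :
    IntegrableOn (fun t => |t * resolventMean c t ω - t * semicircleResolvent t|) (Set.Ioi 0) := by
  have h := (integral_one_sub_mul_semicircleResolvent.1.sub
    (integral_one_sub_mul_resolventMean hn c ω).1).abs
  refine h.congr (Eventually.of_forall fun t => ?_)
  simp only [Pi.sub_apply]
  congr 1
  ring

theorem integrableOn_meanDeviation (hn : 1 ≤ n) (p : I) :
    IntegrableOn (meanDeviation n p) (Set.Ioi 0) := by
  unfold meanDeviation
  simp only [integral_fintype Integrable.of_finite, smul_eq_mul]
  exact integrable_finsetSum _ fun ω _ => (integrableOn_abs_resolventMean_sub hn _ ω).const_mul _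

/-- Subtract the two integral formulas and exchange expectation with the integral over t; the
probability space is finite, so the exchange is linearity over a finite sum. -/
theorem integral_abs_skewEnergy_sub_le (hn : 1 ≤ n) (p : I) :
    ∫ ω, |(Real.sqrt (n * p))⁻¹ * (ofBits ω).skewEnergy / n - 8 / (3 * Real.pi)| ∂bitsLaw n p ≤
      2 / Real.pi * ∫ t in Set.Ioi 0, meanDeviation n p t := by
  set c := (Real.sqrt (n * p))⁻¹ with hc
  have hc0 : 0 ≤ c := by positivity
  have hpt : ∀ ω : VertexPair n → Bool × Bool,
      |c * (ofBits ω).skewEnergy / n - 8 / (3 * Real.pi)| ≤ 2 / Real.pi *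
        ∫ t in Set.Ioi 0, |t * resolventMean c t ω - t * semicircleResolvent t| := fun ω => by
    obtain ⟨h1, h2⟩ := integral_one_sub_mul_resolventMean hn c ω
    obtain ⟨h3, h4⟩ := integral_one_sub_mul_semicircleResolvent
    have h5 : c * (ofBits ω).skewEnergy / n - 8 / (3 * Real.pi) = 2 / Real.pi *
        ∫ t in Set.Ioi 0,
          ((1 - t * resolventMean c t ω) - (1 - t * semicircleResolvent t)) := by
      rw [integral_sub h1 h3, h2, h4, abs_of_nonneg hc0]
      have := Real.pi_ne_zero
      field_simp
      ring
    rw [h5, abs_mul, abs_of_pos (by positivity)]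
    gcongr
    refine abs_integral_le_integral_abs.trans (le_of_eq ?_)
    congr 1
    funext t
    rw [← abs_neg]
    congr 1
    ring
  refine (integral_mono Integrable.of_finite Integrable.of_finite hpt).trans (le_of_eq ?_)
  rw [integral_const_mul]
  congr 1
  unfold meanDeviation
  simp only [integral_fintype Integrable.of_finite, smul_eq_mul, ← hc]
  rw [integral_finsetSum _ fun ω _ => (integrableOn_abs_resolventMean_sub hn c ω).const_mul _]
  simp only [integral_const_mul]

/-- Here n^(3/2)·p^(1/2) = n√(np), and `a` cancels. The last bracket is the explicit value of the
error term r. -/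
theorem skewEnergy_eq_of_pos (hn : 1 ≤ n) {p : I} (hp : 0 < (p : ℝ)) (E a : ℝ) :
    E = (n : ℝ) ^ (3 / 2 : ℝ) * (p : ℝ) ^ (1 / 2 : ℝ) *
      (a + ((Real.sqrt (n * p))⁻¹ * E / n - a)) := by
  have hN0 : (0 : ℝ) < n := by exact_mod_cast hn
  have h1 : (n : ℝ) ^ (3 / 2 : ℝ) = n * Real.sqrt n := by
    rw [show (3 / 2 : ℝ) = 1 + 1 / 2 by norm_num, Real.rpow_add hN0, Real.rpow_one,
      ← Real.sqrt_eq_rpow]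
  have h2 : 0 < Real.sqrt n := Real.sqrt_pos.2 hN0
  have h3 : 0 < Real.sqrt p := Real.sqrt_pos.2 hp
  rw [h1, ← Real.sqrt_eq_rpow, Real.sqrt_mul hN0.le, add_sub_cancel]
  field_simp

theorem tendsto_integral_meanDeviation {p : ℕ → I}
    (hp : Tendsto (fun n : ℕ => (n : ℝ) * p n) atTop atTop) :
    Tendsto (fun n : ℕ => ∫ t in Set.Ioi 0, meanDeviation n (p n) t) atTop (𝓝 0) := by
  have hpos : ∀ᶠ n : ℕ in atTop, 1 ≤ n ∧ 0 < (p n : ℝ) := by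
    filter_upwards [hp.eventually_gt_atTop 0, eventually_ge_atTop 1] with n h1 h2
    exact ⟨h2, pos_of_mul_pos_right h1 (Nat.cast_nonneg n)⟩
  have hlim := tendsto_integral_filter_of_dominated_convergence (l := atTop)
    (μ := volume.restrict (Set.Ioi (0 : ℝ))) (F := fun n : ℕ => meanDeviation n (p n))
    (f := fun _ => 0) (fun t => 3 * (1 + t ^ 2)⁻¹)
    (hpos.mono fun n hn => (integrableOn_meanDeviation hn.1 (p n)).aestronglyMeasurable)
    (hpos.mono fun n hn => (ae_restrict_mem measurableSet_Ioi).mono fun t ht => by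
      rw [Real.norm_eq_abs, abs_of_nonneg (meanDeviation_nonneg _ _ _)]
      exact meanDeviation_le hn.1 hn.2 ht)
    (integrable_inv_one_add_sq.const_mul 3).integrableOn
    ((ae_restrict_mem measurableSet_Ioi).mono fun t ht => ?_)
  · simpa using hlim
  · have ht : 0 < t := ht
    have h1 : Tendsto (fun n : ℕ => (n : ℝ)⁻¹) atTop (𝓝 0) := tendsto_inv_atTop_nhds_zero_nat
    have h2 : Tendsto (fun n : ℕ => (Real.sqrt (n * p n))⁻¹) atTop (𝓝 0) :=
      tendsto_inv_atTop_zero.comp (Real.tendsto_sqrt_atTop.comp hp)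
    have h3 := (((h1.const_mul (3 * t⁻¹ ^ 3)).add (h2.const_mul (24 * t⁻¹ ^ 4))).const_mul t).sqrt
    simp only [mul_zero, add_zero, Real.sqrt_zero] at h3
    refine squeeze_zero' (Eventually.of_forall fun n => meanDeviation_nonneg _ _ _)
      (hpos.mono fun n hn => ?_) h3
    exact Real.le_sqrt_of_sq_le (sq_meanDeviation_le hn.1 hn.2 ht)

end OrientedGraph

/-! ### Convergence in probability and the theorem. -/

/-- Markov's inequality in the form of a quantitative convergence in probability. -/
theorem one_sub_sqrt_le_measureReal {Ω : Type*} [Finite Ω] [MeasurableSpace Ω]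
    [MeasurableSingletonClass Ω] {μ : Measure Ω} [IsProbabilityMeasure μ] {f : Ω → ℝ} {b δ : ℝ}
    (hδ : 0 < δ) (hb : 0 ≤ b) (hbδ : Real.sqrt b ≤ δ) (hf : ∫ ω, |f ω| ∂μ ≤ b) :
    1 - Real.sqrt b ≤ μ.real {ω | |f ω| ≤ δ} := by
  have h1 := mul_meas_ge_le_integral_of_nonneg (μ := μ) (f := fun ω => |f ω|)
    (Eventually.of_forall fun _ => abs_nonneg _) Integrable.of_finite δ
  have h2 : μ.real {ω | δ ≤ |f ω|} ≤ Real.sqrt b := by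
    refine le_of_mul_le_mul_left ?_ hδ
    calc _ ≤ b := h1.trans hf
      _ = Real.sqrt b * Real.sqrt b := (Real.mul_self_sqrt hb).symm
      _ ≤ _ := by gcongr
  have h3 : μ.real ({ω | |f ω| ≤ δ}ᶜ) ≤ μ.real {ω | δ ≤ |f ω|} :=
    measureReal_mono fun ω (hω : ¬|f ω| ≤ δ) => (not_le.1 hω).le
  rw [probReal_compl_eq_one_sub (Set.toFinite _).measurableSet] at h3
  linarith

theorem theorem3p2 (p : ℕ → unitInterval)
    (hp : Tendsto (fun n : ℕ => (p n : ℝ) / (1 / (n : ℝ))) atTop atTop) :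
    (∃ δ : ℕ → ℝ, Tendsto δ atTop (𝓝 0) ∧
      AsymptoticallyAlmostSurely (fun n => randomOrientedGraph n (p n)) fun n G =>
        ∃ r : ℝ, |r| ≤ δ n ∧
          G.skewEnergy = (n : ℝ) ^ (3 / 2 : ℝ) * (p n : ℝ) ^ (1 / 2 : ℝ) *
            (8 / (3 * Real.pi) + r)) ∧
    (∫ x : ℝ, |x| * semicircleDensity x) = 8 / (3 * Real.pi) := by
  refine ⟨?_, integral_abs_mul_semicircleDensity⟩
  have hp' : Tendsto (fun n : ℕ => (n : ℝ) * p n) atTop atTop := by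
    refine hp.congr fun n => ?_
    rw [div_div_eq_mul_div, div_one, mul_comm]
  have hpos : ∀ᶠ n : ℕ in atTop, 1 ≤ n ∧ 0 < (p n : ℝ) := by
    filter_upwards [hp'.eventually_gt_atTop 0, eventually_ge_atTop 1] with n h1 h2
    exact ⟨h2, pos_of_mul_pos_right h1 (Nat.cast_nonneg n)⟩
  let b : ℕ → ℝ := fun n =>
    2 / Real.pi * ∫ t in Set.Ioi 0, OrientedGraph.meanDeviation n (p n) t
  have hb : ∀ n, 0 ≤ b n := fun n => mul_nonneg (by positivity)
    (integral_nonneg fun t => OrientedGraph.meanDeviation_nonneg _ _ _)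
  have hb0 : Tendsto (fun n => Real.sqrt (b n)) atTop (𝓝 0) := by
    simpa using ((OrientedGraph.tendsto_integral_meanDeviation hp').const_mul
      (2 / Real.pi)).sqrt
  -- The square root balances the size of the deviation against its probability. The summand 1/(n +
  -- 1) keeps the threshold positive even if `b n` vanishes.
  refine ⟨fun n => Real.sqrt (b n) + 1 / ((n : ℝ) + 1), ?_, ?_⟩
  · simpa using hb0.add tendsto_one_div_add_atTop_nhds_zero_nat
  · have hlow : Tendsto (fun n => ENNReal.ofReal (1 - Real.sqrt (b n))) atTop (𝓝 1) := by
      simpa using ENNReal.tendsto_ofReal (hb0.const_sub 1)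
    refine tendsto_of_tendsto_of_tendsto_of_le_of_le' hlow tendsto_const_nhds ?_
      (Eventually.of_forall fun n => prob_le_one)
    filter_upwards [hpos] with n hn
    have h := one_sub_sqrt_le_measureReal (δ := Real.sqrt (b n) + 1 / ((n : ℝ) + 1))
      (by positivity) (hb n) (le_add_of_nonneg_right (by positivity))
      (OrientedGraph.integral_abs_skewEnergy_sub_le hn.1 (p n))
    refine (ENNReal.ofReal_le_ofReal h).trans ?_
    rw [ofReal_measureReal, randomOrientedGraph,
      Measure.map_apply (OrientedGraph.measurable_ofBits n) trivial]
    exact measure_mono fun ω hω =>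
      ⟨_, hω, OrientedGraph.skewEnergy_eq_of_pos hn.1 hn.2 _ _⟩
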